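/- Theorem. Let $\mathsf H$ be a real separable Hilbert space, $f\colon\mathsf H\to\mathbb R$ convex and Lipschitz continuous with constant $L>0$, and $\mathsf X\subset\mathsf H$ nonempty, closed and convex with $\operatorname{argmin}_{\mathsf X} f\neq\varnothing$; let $P_{\mathsf X}$ be the orthogonal projection onto $\mathsf X$. Let $\xi$ be a random variable and let $\hat u(\mathsf x,\xi)\in\mathsf H$ ($\mathsf x\in\mathsf X$), jointly measurable in both arguments, satisfy, for every $\mathsf x\in\mathsf X$, $$\mathbb E\|\hat u(\mathsf x,\xi)\|<+\infty,\qquad \mathbb E[\hat u(\mathsf x,\xi)]\in\partial f(\mathsf x),\qquad \mathbb E\big[\|\hat u(\mathsf x,\xi)-\mathbb E[\hat u(\mathsf x,\xi)]\|^p\big]\le\sigma^p,$$ for some $\sigma\ge 0$ and $p\in\,]1,2]$, where $\partial f(\mathsf x)=\{\mathsf u\in\mathsf H : f(\mathsf y)\ge f(\mathsf x)+\langle \mathsf u,\mathsf y-\mathsf x\rangle\ \forall \mathsf y\in\mathsf H\}$. Let $m\ge 1$ be an integer and let $\sigma_m\ge 0$ be such that, for every $\mathsf x\in\mathsf X$,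 the average $\bar u=\frac1m\sum_{j=1}^m\hat u(\mathsf x,\xi_j)$ over i.i.d. copies $\xi_1,\dots,\xi_m$ of $\xi$ satisfies $\mathbb E[\|\bar u-\mathbb E[\bar u]\|^p]\le\sigma_m^p$. Let $\gamma_k>0$ and $\lambda_k>0$ ($k=1,2,\dots$), let $\mathsf x_1\in\mathsf X$, and let $\xi^k_j$ ($k\ge1$, $1\le j\le m$) be copies of $\xi$ that are independent within each batch $(\xi^k_j)_{1\le j\le m}$, the batches being independent too. Consider the clipped stochastic subgradient method $x_1\equiv\mathsf x_1$ and, for $k=1,2,\dots$, $$\bar u_k=\frac1m\sum_{j=1}^m\hat u(x_k,\xi^k_j),\qquad \tilde u_k=\max\{\|\bar u_k\|/\lambda_k,1\}^{-1}\,\bar u_k,\qquad x_{k+1}=P_{\mathsf X}(x_k-\gamma_k\tilde u_k),$$ and set $\bar x_k=\frac1k\sum_{i=1}^k x_i$. Let $\varepsilon>0$ and suppose that $(\gamma_k)$ is decreasing, i.e. $\gamma_{k+1}\le\gamma_k$ for all $k$, and that $\lambda_k\ge L_\varepsilon:=(1+\varepsilon)L$ for all $k$. Let $\mathsf x_*\in\operatorname{argmin}_{\mathsf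 X}f$ and $f_*=\min_{\mathsf X}f$, and define $$a_p=\Big(1+\frac1\varepsilon\Big)^{p-1}\sigma_m^p,\qquad b_p=2^{p-1}(\sigma_m^p+L^p),$$ $$A_k=a_p\sum_{i=1}^k\frac{\gamma_i}{\lambda_i^{p-1}},\quad B_k=b_p\sum_{i=1}^k\gamma_i^2\lambda_i^{2-p},\quad C_k=\max_{1\le i\le k}\gamma_i\lambda_i,\quad D_k=\max_{1\le i\le k}\gamma_i^2\lambda_i^2,\quad E_k=b_p\sum_{i=1}^k\gamma_i^4\lambda_i^{4-p}.$$ Then for every $\delta\in\,]0,2/e]$ and every integer $k\ge1$, with probability at least $1-\delta$, $$f(\bar x_k)-f_*\le\frac1{2k\gamma_k}\bigg(\|\mathsf x_1-\mathsf x_*\|+A_k+B_k+\frac83\,(C_k+D_k)\log\frac2\delta+\big(\sqrt{B_k}+\sqrt{E_k}\big)\sqrt{\log\frac2\delta}\bigg)^2.$$ -/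

import Mathlib

open MeasureTheory ProbabilityTheory
open scoped BigOperators

namespace CSSGM

noncomputable section

/-- The convex subdifferential of a real function on a Hilbert space. -/
def subdifferential {H : Type*} [NormedAddCommGroup H] [InnerProductSpace ℝ H]
    (f : H → ℝ) (x : H) : Set H :=
  {u | ∀ y : H, f x + inner ℝ u (y - x) ≤ f y}

/-- A projection onto a nonempty closed convex set exists. -/
theorem exists_proj {H : Type*} [NormedAddCommGroup H] [InnerProductSpace ℝ H] [CompleteSpace H]
    {X : Set H} (hne : X.Nonempty) (hcl : IsClosed X) (hcv : Convex ℝ X) (x : H) :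
    ∃ p : H, p ∈ X ∧ ∀ y ∈ X, ‖x - p‖ ≤ ‖x - y‖ := by
  obtain ⟨v, hv, h⟩ := exists_norm_eq_iInf_of_complete_convex hne hcl.isComplete hcv x
  refine ⟨v, hv, fun y hy => ?_⟩
  rw [h]
  exact ciInf_le ⟨0, Set.forall_mem_range.2 fun _ => norm_nonneg _⟩ (⟨y, hy⟩ : X)

open Classical in
/-- The metric projection onto `X`: a point of `X` nearest to `x`. For nonempty closed convex `X`
in a Hilbert space there is exactly one such point (if there is none, the value is `x`). -/
def proj {H : Type*} [NormedAddCommGroup H] (X : Set H) (x : H) : H :=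
  if h : ∃ p : H, p ∈ X ∧ ∀ y ∈ X, ‖x - p‖ ≤ ‖x - y‖ then h.choose else x

theorem proj_spec {H : Type*} [NormedAddCommGroup H] [InnerProductSpace ℝ H] [CompleteSpace H]
    {X : Set H} (hne : X.Nonempty) (hcl : IsClosed X) (hcv : Convex ℝ X) (x : H) :
    proj X x ∈ X ∧ ∀ y ∈ X, ‖x - proj X x‖ ≤ ‖x - y‖ := by
  have h := exists_proj hne hcl hcv x
  rw [proj, dif_pos h]
  exact h.choose_spec

/-- The clipping operator `CLIP(u, l) = max{‖u‖ / l, 1}⁻¹ u`. -/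
def clip {H : Type*} [NormedAddCommGroup H] [NormedSpace ℝ H] (u : H) (l : ℝ) : H :=
  (max (‖u‖ / l) 1)⁻¹ • u

/-- The minibatch average `(1/m) ∑_j û(x, z_j)`. -/
def batchMean {H Ξ : Type*} [NormedAddCommGroup H] [NormedSpace ℝ H] {m : ℕ}
    (uhat : H → Ξ → H) (x : H) (z : Fin m → Ξ) : H :=
  (1 / (m : ℝ)) • ∑ j, uhat x (z j)

/-- The iterates `x_k`, `k ≥ 1`, of the clipped stochastic subgradient method with steps `γ k`,
clipping levels `lam k` and draws `ξs k 1, …, ξs k m` for `k ≥ 1`. The indices start from `1`;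
the value at index `0` plays no role. -/
def iterate {H Ξ Ω : Type*} [NormedAddCommGroup H] [NormedSpace ℝ H] {m : ℕ}
    (X : Set H) (uhat : H → Ξ → H) (γ lam : ℕ → ℝ) (x₁ : H) (ξs : ℕ → Fin m → Ω → Ξ) :
    ℕ → Ω → H
  | 0 => fun _ => x₁
  | 1 => fun _ => x₁
  | (k + 2) => fun ω =>
      let x := iterate X uhat γ lam x₁ ξs (k + 1) ω
      proj X (x - γ (k + 1) •
        clip (batchMean uhat x (fun j => ξs (k + 1) j ω)) (lam (k + 1)))

/-- The averaged iterate `(1/k) ∑_{i=1}^k x_i`. -/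
def avgIterate {H Ξ Ω : Type*} [NormedAddCommGroup H] [NormedSpace ℝ H] {m : ℕ}
    (X : Set H) (uhat : H → Ξ → H) (γ lam : ℕ → ℝ) (x₁ : H) (ξs : ℕ → Fin m → Ω → Ξ)
    (k : ℕ) (ω : Ω) : H :=
  (1 / (k : ℝ)) • ∑ i ∈ Finset.Icc 1 k, iterate X uhat γ lam x₁ ξs i ω

/-- `a_p = (1 + 1/ε)^(p-1) σ_m^p`. -/
def aConst (p ε σm : ℝ) : ℝ := (1 + 1 / ε) ^ (p - 1) * σm ^ p

/-- `b_p = 2^(p-1) (σ_m^p + L^p)`. -/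
def bConst (p L σm : ℝ) : ℝ := (2 : ℝ) ^ (p - 1) * (σm ^ p + L ^ p)

/-- `A_k = a_p ∑_{i=1}^k γ_i / λ_i^(p-1)`. -/
def seqA (p ε σm : ℝ) (γ lam : ℕ → ℝ) (k : ℕ) : ℝ :=
  aConst p ε σm * ∑ i ∈ Finset.Icc 1 k, γ i / lam i ^ (p - 1)

/-- `B_k = b_p ∑_{i=1}^k γ_i^2 λ_i^(2-p)`. -/
def seqB (p L σm : ℝ) (γ lam : ℕ → ℝ) (k : ℕ) : ℝ :=
  bConst p L σm * ∑ i ∈ Finset.Icc 1 k, γ i ^ 2 * lam i ^ (2 - p)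

/-- `C_k = max_{1 ≤ i ≤ k} γ_i λ_i`. -/
def seqC (γ lam : ℕ → ℝ) (k : ℕ) (hk : 1 ≤ k) : ℝ :=
  (Finset.Icc 1 k).sup' (Finset.nonempty_Icc.mpr hk) (fun i => γ i * lam i)

/-- `D_k = max_{1 ≤ i ≤ k} γ_i^2 λ_i^2`. -/
def seqD (γ lam : ℕ → ℝ) (k : ℕ) (hk : 1 ≤ k) : ℝ :=
  (Finset.Icc 1 k).sup' (Finset.nonempty_Icc.mpr hk) (fun i => γ i ^ 2 * lam i ^ 2)

/-- `E_k = b_p ∑_{i=1}^k γ_i^4 λ_i^(4-p)`. -/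
def seqE (p L σm : ℝ) (γ lam : ℕ → ℝ) (k : ℕ) : ℝ :=
  bConst p L σm * ∑ i ∈ Finset.Icc 1 k, γ i ^ 4 * lam i ^ (4 - p)

end

end CSSGM

namespace CSSGM

/-! Write `d i` for the distance from the `i`-th iterate to the minimizer. Nonexpansiveness of the
projection and the subgradient inequality give `d (i+1)² + φ i ≤ d i² + η i + q i`, where `φ i` is
`2γ` times the gap, `q i = γ²‖ũ‖²`, and `η i = 2γ⟪u - ũ, x - x_*⟫` is the noise. The obstacle is
that `η i` scales with `d i`, for which no bound is known in advance.

The remedy is the potential `U i = d 0² + K + ∑ η j` (over `j < i`). While `∑ q ≤ K`, it dominates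
`d i²` plus the accumulated gaps. The tangent bound `√(U + η) ≤ √U + η / (2√U)` then turns the noise
into normalised increments, taken in a direction of norm at most one (`sum_le_sq_of_recursion`).

Two Chernoff bounds (`measure_sum_chain_ge_le`), each failing with probability at most `δ/2`, finish
the argument, with `l = log (2/δ)`: `∑ q` stays below `K = (√B + C√l)²`, and the normalised noise
stays below `A + (5/3) C l`. The second rests on `clip_bias_add_variance_le_rpow`: clipping bias and
quadratic term are controlled together by the `p`-th power of the noise, so no separate variance
term appears. Jensen's inequality passes to the averaged iterate. -/

/-- Taylor's bound is applied at `x / 2`, where the argument is below `1`, and the result is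
squared. The range `6/5` and the constant `5/6` are reciprocal, which is what the noise estimate
exploits. -/
theorem exp_le_one_add_add_sq {x : ℝ} (hx : |x| ≤ 6 / 5) :
    Real.exp x ≤ 1 + x + 5 / 6 * x ^ 2 := by
  obtain ⟨y, rfl⟩ : ∃ y, x = 2 * y := ⟨x / 2, by ring⟩
  have hy : |y| ≤ 3 / 5 := by
    rw [abs_mul, abs_two] at hx; linarith
  have h := (abs_le.1 (Real.exp_bound (x := y) (by linarith) (n := 3) (by norm_num))).2
  norm_num [Finset.sum_range_succ, Nat.factorial] at h
  have h1 : Real.exp y ≤ 1 + y + y ^ 2 / 2 + 2 / 15 * y ^ 2 := by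
    have : |y| ^ 3 ≤ 3 / 5 * y ^ 2 := by
      rw [pow_succ, sq_abs]; nlinarith [sq_nonneg y]
    linarith
  have h2 : Real.exp (2 * y) = Real.exp y ^ 2 := by rw [two_mul, Real.exp_add, sq]
  have h3 : Real.exp y ^ 2 ≤ (1 + y + y ^ 2 / 2 + 2 / 15 * y ^ 2) ^ 2 :=
    pow_le_pow_left₀ (Real.exp_pos y).le h1 2
  obtain ⟨h4, h5⟩ := abs_le.1 hy
  rw [h2]
  nlinarith [mul_nonneg (sq_nonneg y) (sub_nonneg.2 h5),
    mul_nonneg (sq_nonneg y) (mul_nonneg (sub_nonneg.2 h5) (by linarith : (0 : ℝ) ≤ y + 3 / 5))]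

/-! ### Clipping: bias, variance and second moment. -/

section Clip

variable {H : Type*} [NormedAddCommGroup H] [InnerProductSpace ℝ H]

theorem clip_of_norm_le {u : H} {l : ℝ} (hl : 0 < l) (hu : ‖u‖ ≤ l) : clip u l = u := by
  rw [clip, max_eq_right ((div_le_one hl).2 hu), inv_one, one_smul]

theorem clip_of_le_norm {u : H} {l : ℝ} (hl : 0 < l) (hu : l ≤ ‖u‖) :
    clip u l = (l / ‖u‖) • u := by
  rw [clip, max_eq_left ((one_le_div hl).2 hu), inv_div]

theorem norm_clip_of_le_norm {u : H} {l : ℝ} (hl : 0 < l) (hu : l ≤ ‖u‖) : ‖clip u l‖ = l := by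
  rw [clip_of_le_norm hl hu, norm_smul, Real.norm_of_nonneg (by positivity),
    div_mul_cancel₀ _ (hl.trans_le hu).ne']

theorem norm_clip_le {u : H} {l : ℝ} (hl : 0 < l) : ‖clip u l‖ ≤ l := by
  rcases le_total ‖u‖ l with h | h
  · rwa [clip_of_norm_le hl h]
  · exact (norm_clip_of_le_norm hl h).le

theorem norm_clip_le_norm {u : H} {l : ℝ} (hl : 0 < l) : ‖clip u l‖ ≤ ‖u‖ := by
  rcases le_total ‖u‖ l with h | h
  · rw [clip_of_norm_le hl h]
  · rwa [norm_clip_of_le_norm hl h]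

theorem sub_clip_of_le_norm {u : H} {l : ℝ} (hl : 0 < l) (hu : l ≤ ‖u‖) :
    u - clip u l = (‖u‖ / l - 1) • clip u l := by
  have hu' : ‖u‖ ≠ 0 := (hl.trans_le hu).ne'
  rw [sub_smul, one_smul, clip_of_le_norm hl hu, smul_smul, div_mul_div_cancel₀ hl.ne',
    div_self hu', one_smul]

/-- Clipping is the projection onto the ball of radius `l`: the removed part `u - clip u l` makes a
nonnegative inner product with `clip u l - v` for every `v` in that ball. -/
theorem norm_clip_sub_le {u v : H} {l : ℝ} (hl : 0 < l) (hv : ‖v‖ ≤ l) :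
    ‖clip u l - v‖ ≤ ‖u - v‖ := by
  rcases le_total ‖u‖ l with h | h
  · rw [clip_of_norm_le hl h]
  have h1 : u - v = (u - clip u l) + (clip u l - v) := by abel
  have h2 : 0 ≤ inner ℝ (u - clip u l) (clip u l - v) := by
    rw [sub_clip_of_le_norm hl h, real_inner_smul_left, inner_sub_right,
      real_inner_self_eq_norm_sq, norm_clip_of_le_norm hl h]
    have h3 := real_inner_le_norm (clip u l) v
    rw [norm_clip_of_le_norm hl h] at h3
    have h4 : 0 ≤ ‖u‖ / l - 1 := by rw [sub_nonneg, one_le_div hl]; exact h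
    exact mul_nonneg h4 (by nlinarith)
  refine le_of_sq_le_sq ?_ (norm_nonneg _)
  rw [h1, norm_add_sq_real]
  nlinarith [sq_nonneg ‖u - clip u l‖]

/-- A clipped vector `clip u l` trades bias against variance in every direction `e`. -/
theorem clip_bias_add_variance_le {u v e : H} {l L : ℝ} (hl : 0 < l) (hv : ‖v‖ ≤ L) (hL : L ≤ l)
    (he : ‖e‖ ≤ 1) :
    inner ℝ (u - clip u l) e + (inner ℝ (clip u l - v) e) ^ 2 / (2 * l) ≤ ‖u - v‖ := by
  have hin : ∀ w : H, |inner ℝ w e| ≤ ‖w‖ := fun w =>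
    (abs_real_inner_le_norm w e).trans (mul_le_of_le_one_right (norm_nonneg _) he)
  set b := inner ℝ (u - clip u l) e with hb
  set y := inner ℝ (clip u l - v) e with hy
  have hs : b + y ≤ ‖u - v‖ := by
    rw [hb, hy, ← inner_add_left, sub_add_sub_cancel]
    exact (le_abs_self _).trans (hin _)
  have hy1 : |y| ≤ ‖u - v‖ := (hin _).trans (norm_clip_sub_le hl (hv.trans hL))
  have hy2 : |y| ≤ 2 * l := by
    refine (hin _).trans ((norm_sub_le _ _).trans ?_)
    linarith [norm_clip_le (u := u) hl]
  have hq : y ^ 2 / (2 * l) ≤ |y| := by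
    rw [div_le_iff₀ (by linarith), ← sq_abs]
    nlinarith [abs_nonneg y]
  rcases le_or_gt 0 y with h0 | h0
  · rw [abs_of_nonneg h0] at hq
    linarith
  rcases le_or_gt b 0 with hb0 | hb0
  · linarith
  rcases le_total ‖u‖ l with h | h
  · rw [clip_of_norm_le hl h, sub_self, inner_zero_left] at hb
    linarith
  -- In the remaining case clipping is active and `y < 0 < b`. The bias costs at most the fraction
  -- `z / l` of `‖u - v‖`, and the quadratic term at most the complementary fraction `(l - z) / l`.
  set z := inner ℝ (clip u l) e with hz
  have hbz : b = (‖u‖ / l - 1) * z := by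
    rw [hb, sub_clip_of_le_norm hl h, real_inner_smul_left]
  have h4 : 0 ≤ ‖u‖ / l - 1 := by rw [sub_nonneg, one_le_div hl]; exact h
  have hz0 : 0 < z := by
    by_contra hc
    rw [hbz] at hb0
    nlinarith
  have hzl : z ≤ l := (le_abs_self _).trans ((hin _).trans (norm_clip_le hl))
  have hyz : |y| ≤ l - z := by
    rw [abs_of_neg h0, hy, inner_sub_left]
    linarith [(le_abs_self _).trans (hin v)]
  have hr : ‖u‖ - l ≤ ‖u - v‖ := by linarith [norm_sub_norm_le u v]
  have hb1 : b ≤ ‖u - v‖ * (z / l) := by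
    have : b = (‖u‖ - l) * (z / l) := by rw [hbz]; field_simp
    rw [this]
    exact mul_le_mul_of_nonneg_right hr (by positivity)
  have hq1 : y ^ 2 / (2 * l) ≤ ‖u - v‖ * ((l - z) / l) := by
    rw [mul_div_assoc', div_le_div_iff₀ (by linarith) hl, ← sq_abs]
    have := mul_le_mul hy1 hyz (abs_nonneg y) (norm_nonneg _)
    nlinarith [mul_nonneg (norm_nonneg (u - v)) (sub_nonneg.2 hzl)]
  have : ‖u - v‖ * (z / l) + ‖u - v‖ * ((l - z) / l) = ‖u - v‖ := by field_simp; ring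
  linarith

theorem clip_bias_add_variance_le_rpow {u v e : H} {l L p ε : ℝ} (hL0 : 0 < L) (hε : 0 < ε)
    (hv : ‖v‖ ≤ L) (hL : (1 + ε) * L ≤ l) (he : ‖e‖ ≤ 1) (hp1 : 1 < p) (hp2 : p ≤ 2) :
    inner ℝ (u - clip u l) e + (inner ℝ (clip u l - v) e) ^ 2 / (2 * l)
      ≤ (1 + 1 / ε) ^ (p - 1) / l ^ (p - 1) * ‖u - v‖ ^ p := by
  have hl : 0 < l := lt_of_lt_of_le (by positivity) hL
  have hLl : L ≤ l := by nlinarith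
  set s := ‖u - v‖ with hs
  have hs0 : 0 ≤ s := norm_nonneg _
  set c := 1 + 1 / ε with hc
  have hc1 : 1 ≤ c := by rw [hc]; linarith [one_div_pos.2 hε]
  have hc0 : 0 < c := by linarith
  -- The threshold `t = lε/(1+ε)` satisfies `L + t ≤ l`. Noise below `t` therefore triggers no
  -- clipping and leaves only the quadratic term, while noise `s ≥ t` satisfies `s ≤ t^(1-p) s^p`.
  set t := l / c with ht
  have ht0 : 0 < t := by positivity
  have hct : c ^ (p - 1) / l ^ (p - 1) = t ^ (1 - p) := by
    rw [← Real.div_rpow hc0.le hl.le, ← neg_sub p 1, Real.rpow_neg ht0.le,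
      ← Real.inv_rpow ht0.le, ht, inv_div]
  have htl : t ≤ l := div_le_self hl.le hc1
  have hLt : L + t ≤ l := by
    have h1 : t = l - l / (1 + ε) := by rw [ht, hc]; field_simp; ring
    have h2 : L ≤ l / (1 + ε) := by rw [le_div_iff₀ (by linarith)]; linarith
    linarith
  rw [hct]
  rcases le_or_gt t s with h | h
  · refine (clip_bias_add_variance_le hl hv hLl he).trans ?_
    have hs1 : 0 < s := ht0.trans_le h
    have h1 : s ^ (1 - p) ≤ t ^ (1 - p) :=
      Real.rpow_le_rpow_of_nonpos ht0 h (by linarith)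
    calc s = s ^ (1 - p) * s ^ p := by
          rw [← Real.rpow_add hs1]; simp
      _ ≤ _ := mul_le_mul_of_nonneg_right h1 (by positivity)
  · have hu : ‖u‖ ≤ l := by
      have := norm_sub_norm_le u v
      linarith
    rw [clip_of_norm_le hl hu, sub_self, inner_zero_left, zero_add]
    have h1 : (inner ℝ (u - v) e : ℝ) ^ 2 ≤ s ^ 2 := by
      rw [← sq_abs]
      exact pow_le_pow_left₀ (abs_nonneg _)
        ((abs_real_inner_le_norm _ e).trans (mul_le_of_le_one_right (norm_nonneg _) he)) 2
    rcases hs0.eq_or_lt with h0 | h0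
    · rw [← h0] at h1 ⊢
      rw [Real.zero_rpow (by linarith), mul_zero]
      have : (inner ℝ (u - v) e : ℝ) ^ 2 = 0 := le_antisymm (by simpa using h1) (sq_nonneg _)
      rw [this, zero_div]
    have h2 : s ^ 2 = s ^ (2 - p) * s ^ p := by
      rw [← Real.rpow_add h0, sub_add_cancel, Real.rpow_two]
    have h3 : s ^ (2 - p) ≤ t ^ (2 - p) := Real.rpow_le_rpow hs0 h.le (by linarith)
    have h4 : t ^ (2 - p) = t * t ^ (1 - p) := by
      rw [show 2 - p = 1 + (1 - p) by ring, Real.rpow_add ht0, Real.rpow_one]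
    rw [div_le_iff₀ (by linarith)]
    have h5 : s ^ 2 ≤ l * t ^ (1 - p) * s ^ p := by
      rw [h2]
      refine mul_le_mul_of_nonneg_right (h3.trans ?_) (by positivity)
      rw [h4]
      exact mul_le_mul_of_nonneg_right htl (by positivity)
    have : 0 ≤ l * t ^ (1 - p) * s ^ p := by positivity
    nlinarith

theorem norm_clip_sq_le_rpow {u v : H} {l L p : ℝ} (hl : 0 < l) (hL : 0 < L) (hv : ‖v‖ ≤ L)
    (hp1 : 1 < p) (hp2 : p ≤ 2) :
    ‖clip u l‖ ^ 2 ≤ l ^ (2 - p) * (2 ^ (p - 1) * (‖u - v‖ ^ p + L ^ p)) := by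
  have h1 : ‖u‖ ^ p ≤ 2 ^ (p - 1) * (‖u - v‖ ^ p + L ^ p) := by
    have h2 : ‖u‖ ≤ ‖u - v‖ + L := by linarith [norm_sub_norm_le u v]
    have h3 := NNReal.rpow_add_le_mul_rpow_add_rpow ‖u - v‖.toNNReal L.toNNReal hp1.le
    have h4 : (‖u - v‖ + L) ^ p ≤ 2 ^ (p - 1) * (‖u - v‖ ^ p + L ^ p) := by
      have := NNReal.coe_le_coe.2 h3
      push_cast at this
      rwa [Real.coe_toNNReal _ (norm_nonneg _), Real.coe_toNNReal _ hL.le] at this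
    exact (Real.rpow_le_rpow (norm_nonneg _) h2 (by linarith)).trans h4
  have h5 : ‖clip u l‖ ^ 2 ≤ l ^ (2 - p) * ‖clip u l‖ ^ p := by
    rcases (norm_nonneg (clip u l)).eq_or_lt with h0 | h0
    · rw [← h0, Real.zero_rpow (by linarith)]; simp
    · have : ‖clip u l‖ ^ 2 = ‖clip u l‖ ^ (2 - p) * ‖clip u l‖ ^ p := by
        rw [← Real.rpow_add h0, sub_add_cancel, Real.rpow_two]
      rw [this]
      exact mul_le_mul_of_nonneg_right
        (Real.rpow_le_rpow h0.le (norm_clip_le hl) (by linarith)) (by positivity)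
  refine h5.trans (mul_le_mul_of_nonneg_left ?_ (by positivity))
  exact (Real.rpow_le_rpow (norm_nonneg _) (norm_clip_le_norm hl) (by linarith)).trans h1

theorem continuous_clip (l : ℝ) : Continuous fun u : H => clip u l := by
  unfold clip
  refine Continuous.smul (Continuous.inv₀ (by fun_prop) fun u => ?_) continuous_id
  exact (lt_of_lt_of_le one_pos (le_max_right _ _)).ne'

end Clip

/-! ### Subgradient norms and the projection. -/

theorem norm_le_of_mem_subdifferential {H : Type*} [NormedAddCommGroup H] [InnerProductSpace ℝ H]
    {f : H → ℝ} {L : ℝ} (hL : 0 < L) (hf : LipschitzWith L.toNNReal f) {x u : H}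
    (hu : u ∈ subdifferential f x) : ‖u‖ ≤ L := by
  have h1 := hu (x + u)
  have h2 := hf.dist_le_mul (x + u) x
  rw [add_sub_cancel_left, real_inner_self_eq_norm_sq] at h1
  rw [dist_self_add_left, Real.coe_toNNReal _ hL.le, Real.dist_eq] at h2
  have h3 := le_abs_self (f (x + u) - f x)
  by_contra hc
  nlinarith [norm_nonneg u]

section Projection

variable {H : Type*} [NormedAddCommGroup H] [InnerProductSpace ℝ H] [CompleteSpace H]
  {X : Set H}

theorem inner_sub_proj_le_zero (hne : X.Nonempty) (hcl : IsClosed X) (hcv : Convex ℝ X) (x : H)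
    {y : H} (hy : y ∈ X) : inner ℝ (x - proj X x) (y - proj X x) ≤ 0 := by
  obtain ⟨h1, h2⟩ := proj_spec hne hcl hcv x
  refine (norm_eq_iInf_iff_real_inner_le_zero hcv h1).1 ?_ y hy
  have : Nonempty X := hne.to_subtype
  refine le_antisymm (le_ciInf fun w => h2 w w.2) ?_
  exact ciInf_le (f := fun w : X => ‖x - w‖) ⟨0, Set.forall_mem_range.2 fun _ => norm_nonneg _⟩
    ⟨proj X x, h1⟩

theorem norm_proj_sub_proj_le (hne : X.Nonempty) (hcl : IsClosed X) (hcv : Convex ℝ X)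
    (x y : H) : ‖proj X x - proj X y‖ ≤ ‖x - y‖ := by
  have h1 := inner_sub_proj_le_zero hne hcl hcv x (proj_spec hne hcl hcv y).1
  have h2 := inner_sub_proj_le_zero hne hcl hcv y (proj_spec hne hcl hcv x).1
  have h3 : inner ℝ (x - y) (proj X x - proj X y) = ‖proj X x - proj X y‖ ^ 2
      - inner ℝ (x - proj X x) (proj X y - proj X x)
      - inner ℝ (y - proj X y) (proj X x - proj X y) := by
    rw [← real_inner_self_eq_norm_sq]
    simp only [inner_sub_left, inner_sub_right]
    ring
  have h4 := real_inner_le_norm (x - y) (proj X x - proj X y)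
  by_contra hc
  nlinarith [norm_nonneg (x - y)]

theorem continuous_proj (hne : X.Nonempty) (hcl : IsClosed X) (hcv : Convex ℝ X) :
    Continuous (proj X) :=
  LipschitzWith.continuous (K := 1) (LipschitzWith.of_dist_le_mul fun x y => by
    simpa [dist_eq_norm] using norm_proj_sub_proj_le hne hcl hcv x y)

theorem norm_proj_sub_le (hne : X.Nonempty) (hcl : IsClosed X) (hcv : Convex ℝ X) (x : H)
    {y : H} (hy : y ∈ X) : ‖proj X x - y‖ ≤ ‖x - y‖ := by
  have h := norm_proj_sub_proj_le hne hcl hcv x y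
  have : proj X y = y := by
    have h2 := (proj_spec hne hcl hcv y).2 y hy
    rw [sub_self, norm_zero] at h2
    exact (sub_eq_zero.1 (norm_le_zero_iff.1 h2)).symm
  rwa [this] at h

end Projection

/-! ### Exponential moments of clipped vectors. -/

theorem integrable_rpow_norm_of_lintegral_le {H E : Type*} [NormedAddCommGroup H]
    [MeasurableSpace E] {ν : Measure E} {n : E → H} (hn : AEStronglyMeasurable n ν)
    {p c : ℝ} (hp : 0 < p) (hc : 0 ≤ c) (h : ∫⁻ z, ‖n z‖ₑ ^ p ∂ν ≤ ENNReal.ofReal c) :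
    Integrable (fun z => ‖n z‖ ^ p) ν ∧ ∫ z, ‖n z‖ ^ p ∂ν ≤ c := by
  have he : ∀ z, ‖n z‖ₑ ^ p = ENNReal.ofReal (‖n z‖ ^ p) := fun z => by
    rw [← ofReal_norm, ENNReal.ofReal_rpow_of_nonneg (norm_nonneg _) hp.le]
  simp only [he] at h
  have hm : AEStronglyMeasurable (fun z => ‖n z‖ ^ p) ν :=
    (hn.norm.aemeasurable.pow_const p).aestronglyMeasurable
  have h0 : ∀ z, 0 ≤ ‖n z‖ ^ p := fun z => by positivity
  have hi : Integrable (fun z => ‖n z‖ ^ p) ν :=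
    (lintegral_ofReal_ne_top_iff_integrable hm (ae_of_all _ h0)).1
      (h.trans_lt ENNReal.ofReal_lt_top).ne
  refine ⟨hi, ?_⟩
  rwa [← ofReal_integral_eq_lintegral_ofReal hi (ae_of_all _ h0),
    ENNReal.ofReal_le_ofReal_iff hc] at h

/-- Since `1 + c ≤ exp c`, a pointwise majorant `1 + k` reduces an exponential moment to the mean of
`k`. -/
theorem lintegral_ofReal_exp_le {E : Type*} [MeasurableSpace E] {ν : Measure E}
    [IsProbabilityMeasure ν] {h k : E → ℝ} (hk : Integrable k ν)
    (hle : ∀ z, Real.exp (h z) ≤ 1 + k z) {c : ℝ} (hc : ∫ z, k z ∂ν ≤ c) :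
    ∫⁻ z, ENNReal.ofReal (Real.exp (h z)) ∂ν ≤ ENNReal.ofReal (Real.exp c) := by
  have hi : Integrable (fun z => 1 + k z) ν := (integrable_const 1).add hk
  calc ∫⁻ z, ENNReal.ofReal (Real.exp (h z)) ∂ν ≤ ∫⁻ z, ENNReal.ofReal (1 + k z) ∂ν :=
        lintegral_mono fun z => ENNReal.ofReal_le_ofReal (hle z)
    _ = ENNReal.ofReal (∫ z, (1 + k z) ∂ν) :=
        (ofReal_integral_eq_lintegral_ofReal hi
          (ae_of_all _ fun z => (Real.exp_pos _).le.trans (hle z))).symm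
    _ ≤ _ := by
        refine ENNReal.ofReal_le_ofReal ?_
        rw [integral_add (integrable_const 1) hk, integral_const, probReal_univ, one_smul]
        linarith [Real.add_one_le_exp c]

section Moments

variable {H : Type*} [NormedAddCommGroup H] [InnerProductSpace ℝ H]
  {E : Type*} [MeasurableSpace E] {ν : Measure E} [IsProbabilityMeasure ν]

variable {V : E → H} {u : H} {l L p ε s : ℝ}

/-- The exponent splits into the clipping bias and the unclipped noise, whose mean is zero. The
quadratic term of the exponential is absorbed into the bias estimate, so only `aConst` survives. -/
theorem lintegral_exp_inner_clip_le [CompleteSpace H] (hV : Integrable V ν) (hVu : ∫ z, V z ∂ν = u)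
    (hL0 : 0 < L) (hε : 0 < ε) (hu : ‖u‖ ≤ L) (hL : (1 + ε) * L ≤ l) (hp1 : 1 < p) (hp2 : p ≤ 2)
    (hs : 0 ≤ s) (hmom : ∫⁻ z, ‖V z - u‖ₑ ^ p ∂ν ≤ ENNReal.ofReal (s ^ p)) {e : H} (he : ‖e‖ ≤ 1)
    {τ : ℝ} (hτ : 0 ≤ τ) (hτl : τ * l ≤ 3 / 5) :
    ∫⁻ z, ENNReal.ofReal (Real.exp (τ * inner ℝ (u - clip (V z) l) e)) ∂ν
      ≤ ENNReal.ofReal (Real.exp (τ * (aConst p ε s / l ^ (p - 1)))) := by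
  have hl : 0 < l := lt_of_lt_of_le (by positivity) hL
  have hVs : AEStronglyMeasurable (fun z => V z - u) ν :=
    hV.aestronglyMeasurable.sub aestronglyMeasurable_const
  obtain ⟨hi, hle⟩ := integrable_rpow_norm_of_lintegral_le hVs (by linarith) (by positivity) hmom
  have hin : Integrable (fun z => inner ℝ e (V z - u)) ν :=
    (hV.sub (integrable_const u)).const_inner e
  set a := (1 + 1 / ε) ^ (p - 1) / l ^ (p - 1) with ha
  have ha0 : 0 ≤ a := by positivity
  have hE : ∫ z, inner ℝ e (V z - u) ∂ν = 0 := by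
    rw [integral_inner (f := fun z => V z - u) (hV.sub (integrable_const u)), integral_sub hV (integrable_const u), hVu]
    simp
  refine lintegral_ofReal_exp_le (k := fun z => τ * (a * ‖V z - u‖ ^ p - inner ℝ e (V z - u)))
    (((hi.const_mul a).sub hin).const_mul τ) (fun z => ?_) ?_
  · set y := inner ℝ (clip (V z) l - u) e with hy
    have h1 : inner ℝ (u - clip (V z) l) e = -y := by
      rw [hy, ← inner_neg_left, neg_sub]
    have hyl : |y| ≤ 2 * l := by
      refine (abs_real_inner_le_norm _ _).trans
        ((mul_le_of_le_one_right (norm_nonneg _) he).trans ((norm_sub_le _ _).trans ?_))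
      have : L ≤ l := by nlinarith
      linarith [norm_clip_le (u := V z) hl]
    have h2 : |τ * -y| ≤ 6 / 5 := by
      rw [abs_mul, abs_neg, abs_of_nonneg hτ]
      nlinarith
    have h3 := exp_le_one_add_add_sq h2
    have h4 := clip_bias_add_variance_le_rpow (u := V z) hL0 hε hu hL he hp1 hp2
    have h5 : inner ℝ (V z - clip (V z) l) e = inner ℝ e (V z - u) - y := by
      rw [hy, real_inner_comm (V z - u) e, ← inner_sub_left, sub_sub_sub_cancel_right]
    rw [← hy, h5] at h4
    -- The ratio of the two sides is `(5/3) τ l`, so `τ l ≤ 3/5` is exactly the condition needed.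
    have h6 : 5 / 6 * (τ * -y) ^ 2 ≤ τ * (y ^ 2 / (2 * l)) := by
      have h7 : y ^ 2 / (2 * l) * (2 * l) = y ^ 2 := by field_simp
      have h8 : 0 ≤ τ * (y ^ 2 / (2 * l)) := by positivity
      have h9 : 5 / 6 * (τ * -y) ^ 2 = (τ * (y ^ 2 / (2 * l))) * (5 / 3 * (τ * l)) := by
        rw [mul_neg, neg_sq, mul_pow]
        nth_rewrite 1 [← h7]
        ring
      rw [h9]
      exact mul_le_of_le_one_right h8 (by linarith)
    rw [h1]
    nlinarith [mul_le_mul_of_nonneg_left h4 hτ]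
  · rw [integral_const_mul, integral_sub (hi.const_mul a) hin, hE, sub_zero, integral_const_mul]
    refine mul_le_mul_of_nonneg_left ?_ hτ
    rw [aConst, mul_div_right_comm]
    exact mul_le_mul_of_nonneg_left hle ha0

/-- For `0 ≤ q ≤ x ≤ 1`, `exp q ≤ 1 + q + q² ≤ 1 + (1 + x) q`. The parameter `x` is kept free so
that the Chernoff rate can be tuned later. -/
theorem lintegral_exp_norm_clip_sq_le (hV : Integrable V ν) (hL0 : 0 < L) (hl : 0 < l)
    (hu : ‖u‖ ≤ L) (hp1 : 1 < p) (hp2 : p ≤ 2)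
    (hs : 0 ≤ s) (hmom : ∫⁻ z, ‖V z - u‖ₑ ^ p ∂ν ≤ ENNReal.ofReal (s ^ p))
    {τ x : ℝ} (hτ : 0 ≤ τ) (hx : x ≤ 1) (hτl : τ * l ^ 2 ≤ x) :
    ∫⁻ z, ENNReal.ofReal (Real.exp (τ * ‖clip (V z) l‖ ^ 2)) ∂ν
      ≤ ENNReal.ofReal (Real.exp (τ * ((1 + x) * (bConst p L s * l ^ (2 - p))))) := by
  have hVs : AEStronglyMeasurable (fun z => V z - u) ν :=
    hV.aestronglyMeasurable.sub aestronglyMeasurable_const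
  obtain ⟨hi, hle⟩ := integrable_rpow_norm_of_lintegral_le hVs (by linarith) (by positivity) hmom
  have hx0 : 0 ≤ x := le_trans (by positivity) hτl
  have hiL : Integrable (fun z => ‖V z - u‖ ^ p + L ^ p) ν := hi.add (integrable_const _)
  refine lintegral_ofReal_exp_le (k := fun z => τ * ((1 + x) *
    (l ^ (2 - p) * (2 ^ (p - 1) * (‖V z - u‖ ^ p + L ^ p)))))
    ((((hiL.const_mul _).const_mul _).const_mul _).const_mul _) (fun z => ?_) ?_
  · have h1 : ‖clip (V z) l‖ ^ 2 ≤ l ^ 2 :=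
      pow_le_pow_left₀ (norm_nonneg _) (norm_clip_le hl) 2
    set q := τ * ‖clip (V z) l‖ ^ 2 with hq
    have hq0 : 0 ≤ q := by positivity
    have hqx : q ≤ x := (mul_le_mul_of_nonneg_left h1 hτ).trans hτl
    have h2 := (abs_le.1 (Real.abs_exp_sub_one_sub_id_le (x := q)
      (by rw [abs_of_nonneg hq0]; linarith))).2
    have h3 : q * (1 + x) ≤ τ * ((1 + x) *
        (l ^ (2 - p) * (2 ^ (p - 1) * (‖V z - u‖ ^ p + L ^ p)))) := by
      rw [hq, mul_assoc, mul_comm _ (1 + x)]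
      have := norm_clip_sq_le_rpow (u := V z) hl hL0 hu hp1 hp2
      gcongr
    nlinarith
  · rw [integral_const_mul, integral_const_mul, integral_const_mul, integral_const_mul,
      integral_add hi (integrable_const _), integral_const, probReal_univ, one_smul, bConst,
      mul_comm (2 ^ (p - 1) * _) (l ^ (2 - p))]
    gcongr

end Moments

/-! ### Integrability and mean of the minibatch. -/

section Batch

variable {H : Type*} [NormedAddCommGroup H] [InnerProductSpace ℝ H] {Ξ : Type*} [MeasurableSpace Ξ]

theorem integrable_batchMean {μ : Measure Ξ} [IsProbabilityMeasure μ] {m : ℕ} {uhat : H → Ξ → H}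
    {x : H} (h : Integrable (uhat x) μ) :
    Integrable (fun z : Fin m → Ξ => batchMean uhat x z) (Measure.pi fun _ => μ) := by
  refine Integrable.smul _ (integrable_finsetSum _ fun j _ => ?_)
  exact (measurePreserving_eval (fun _ : Fin m => μ) j).integrable_comp_of_integrable h

theorem integral_batchMean {μ : Measure Ξ} [IsProbabilityMeasure μ] {m : ℕ} (hm : 1 ≤ m)
    {uhat : H → Ξ → H} {x : H} (h : Integrable (uhat x) μ) :
    ∫ z : Fin m → Ξ, batchMean uhat x z ∂(Measure.pi fun _ => μ) = ∫ y, uhat x y ∂μ := by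
  have hp := measurePreserving_eval (fun _ : Fin m => μ)
  have hj : ∀ j : Fin m, ∫ z : Fin m → Ξ, uhat x (z j) ∂(Measure.pi fun _ => μ)
      = ∫ y, uhat x y ∂μ := fun j => by
    have h1 : AEStronglyMeasurable (uhat x)
        ((Measure.pi fun _ : Fin m => μ).map (Function.eval j)) := by
      rw [(hp j).map_eq]; exact h.aestronglyMeasurable
    have h2 := integral_map (hp j).aemeasurable h1
    rw [(hp j).map_eq] at h2
    exact h2.symm
  unfold batchMean
  rw [integral_smul, integral_finsetSum (f := fun j (z : Fin m → Ξ) => uhat x (z j)) _ fun j _ =>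
      (hp j).integrable_comp_of_integrable h,
    Finset.sum_congr rfl fun j _ => hj j, Finset.sum_const, Finset.card_univ, Fintype.card_fin,
    ← Nat.cast_smul_eq_nsmul ℝ, smul_smul, one_div, inv_mul_cancel₀, one_smul]
  exact_mod_cast (by omega : m ≠ 0)

end Batch

/-! ### Chains driven by independent noise, and Chernoff's bound. -/

/-- The Markov chain with transition maps `Φ`, noise `Y` and initial state `z₀`. -/
def chain {S E Ω : Type*} (Φ : ℕ → S × E → S) (Y : ℕ → Ω → E) (z₀ : S) : ℕ → Ω → S
  | 0 => fun _ => z₀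
  | n + 1 => fun ω => Φ n (chain Φ Y z₀ n ω, Y n ω)

theorem measurable_chain {S E Ω : Type*} [MeasurableSpace S] [MeasurableSpace E]
    {Φ : ℕ → S × E → S} (hΦ : ∀ n, Measurable (Φ n)) {Y : ℕ → Ω → E} (z₀ : S) (n : ℕ) :
    Measurable[⨆ i ∈ Set.Iio n, MeasurableSpace.comap (Y i) inferInstance] (chain Φ Y z₀ n) := by
  induction n with
  | zero => exact measurable_const
  | succ n ih =>
    refine (hΦ n).comp (Measurable.prodMk ?_ ?_)
    · exact ih.mono (biSup_mono fun i hi => Nat.lt_succ_of_lt hi) le_rfl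
    · refine (comap_measurable (Y n)).mono ?_ le_rfl
      exact le_iSup₂ (f := fun i (_ : i ∈ Set.Iio (n + 1)) =>
        MeasurableSpace.comap (Y i) inferInstance) n (Nat.lt_succ_self n)

theorem past_le {E Ω : Type*} [MeasurableSpace E] [mΩ : MeasurableSpace Ω] {Y : ℕ → Ω → E}
    (hY : ∀ n, Measurable (Y n)) (n : ℕ) :
    (⨆ i ∈ Set.Iio n, MeasurableSpace.comap (Y i) inferInstance) ≤ mΩ :=
  iSup₂_le fun i _ => (hY i).comap_le

theorem indepFun_of_measurable_past {S E Ω : Type*} [MeasurableSpace S] [MeasurableSpace E]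
    [mΩ : MeasurableSpace Ω] {P : Measure Ω} {Y : ℕ → Ω → E} (hY : ∀ n, Measurable (Y n))
    (hind : iIndepFun Y P) {n : ℕ} {Z : Ω → S}
    (hZ : Measurable[⨆ i ∈ Set.Iio n, MeasurableSpace.comap (Y i) inferInstance] Z) :
    IndepFun Z (Y n) P := by
  rw [IndepFun_iff_Indep]
  have h1 := indep_iSup_of_disjoint (fun i => (hY i).comap_le) hind.iIndep
    (S := Set.Iio n) (T := {n}) (by simp)
  refine indep_of_indep_of_le_left (indep_of_indep_of_le_right h1 ?_) hZ.comap_le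
  simp

/-- The product is a nonnegative supermartingale. Each induction step integrates out the newest
noise by Fubini, since it is independent of the past. -/
theorem lintegral_prod_chain_le_one {S E Ω : Type*} [MeasurableSpace S] [MeasurableSpace E]
    [MeasurableSpace Ω] {P : Measure Ω} [IsProbabilityMeasure P] {ν : Measure E} [SFinite ν]
    {Φ : ℕ → S × E → S} (hΦ : ∀ n, Measurable (Φ n)) {Y : ℕ → Ω → E} (hY : ∀ n, Measurable (Y n))
    (hlaw : ∀ n, P.map (Y n) = ν) (hind : iIndepFun Y P) (z₀ : S)
    {g : ℕ → S × E → ENNReal} (hg : ∀ n, Measurable (g n))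
    (hg1 : ∀ n z, ∫⁻ y, g n (z, y) ∂ν ≤ 1) (n : ℕ) :
    ∫⁻ ω, ∏ i ∈ Finset.range n, g i (chain Φ Y z₀ i ω, Y i ω) ∂P ≤ 1 := by
  induction n with
  | zero => simp
  | succ n ih =>
    set W : Ω → ENNReal := fun ω => ∏ i ∈ Finset.range n, g i (chain Φ Y z₀ i ω, Y i ω) with hW
    have hWm : Measurable[⨆ i ∈ Set.Iio n, MeasurableSpace.comap (Y i) inferInstance] W := by
      refine Finset.measurable_fun_prod _ fun i hi => (hg i).comp (Measurable.prodMk ?_ ?_)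
      · refine (measurable_chain hΦ z₀ i).mono ?_ le_rfl
        exact biSup_mono fun j hj => lt_trans hj (Finset.mem_range.1 hi)
      · refine (comap_measurable (Y i)).mono ?_ le_rfl
        exact le_iSup₂ (f := fun i (_ : i ∈ Set.Iio n) =>
          MeasurableSpace.comap (Y i) inferInstance) i (Finset.mem_range.1 hi)
    -- The weight is paired with the state so that both are jointly independent of `Y n`.
    have hZm : Measurable[⨆ i ∈ Set.Iio n, MeasurableSpace.comap (Y i) inferInstance]
        fun ω => (chain Φ Y z₀ n ω, W ω) :=
      (measurable_chain hΦ z₀ n).prodMk hWm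
    have hZ : Measurable fun ω => (chain Φ Y z₀ n ω, W ω) := hZm.mono (past_le hY n) le_rfl
    have hI := indepFun_of_measurable_past hY hind hZm
    have hmap := (indepFun_iff_map_prod_eq_prod_map_map hZ.aemeasurable (hY n).aemeasurable).1 hI
    rw [hlaw n] at hmap
    have hF : Measurable fun q : (S × ENNReal) × E => q.1.2 * g n (q.1.1, q.2) :=
      (measurable_snd.comp measurable_fst).mul
        ((hg n).comp ((measurable_fst.comp measurable_fst).prodMk measurable_snd))
    calc ∫⁻ ω, ∏ i ∈ Finset.range (n + 1), g i (chain Φ Y z₀ i ω, Y i ω) ∂P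
        = ∫⁻ ω, W ω * g n (chain Φ Y z₀ n ω, Y n ω) ∂P := by
          simp only [Finset.prod_range_succ, hW]
      _ = ∫⁻ q, q.1.2 * g n (q.1.1, q.2)
            ∂(P.map fun ω => ((chain Φ Y z₀ n ω, W ω), Y n ω)) :=
          (lintegral_map hF (hZ.prodMk (hY n))).symm
      _ = ∫⁻ z, ∫⁻ y, z.2 * g n (z.1, y) ∂ν ∂(P.map fun ω => (chain Φ Y z₀ n ω, W ω)) := by
          rw [hmap, lintegral_prod _ hF.aemeasurable]
      _ ≤ ∫⁻ z, z.2 ∂(P.map fun ω => (chain Φ Y z₀ n ω, W ω)) := by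
          refine lintegral_mono fun z => ?_
          rw [lintegral_const_mul _ (f := fun y => g n (z.1, y))
            ((hg n).comp measurable_prodMk_left)]
          exact mul_le_of_le_one_right' (hg1 n z.1)
      _ = ∫⁻ ω, W ω ∂P := lintegral_map measurable_snd hZ
      _ ≤ 1 := ih

/-- Chernoff's bound along a chain whose conditional exponential moments are controlled. -/
theorem measure_sum_chain_ge_le {S E Ω : Type*} [MeasurableSpace S] [MeasurableSpace E]
    [MeasurableSpace Ω] {P : Measure Ω} [IsProbabilityMeasure P] {ν : Measure E} [SFinite ν]
    {Φ : ℕ → S × E → S} (hΦ : ∀ n, Measurable (Φ n)) {Y : ℕ → Ω → E} (hY : ∀ n, Measurable (Y n))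
    (hlaw : ∀ n, P.map (Y n) = ν) (hind : iIndepFun Y P) (z₀ : S)
    {h : ℕ → S × E → ℝ} (hh : ∀ n, Measurable (h n)) {θ : ℝ} (hθ : 0 < θ) {c : ℕ → ℝ} {N : ℕ}
    (hmgf : ∀ n < N, ∀ z, ∫⁻ y, ENNReal.ofReal (Real.exp (θ * h n (z, y))) ∂ν
      ≤ ENNReal.ofReal (Real.exp (θ * c n))) (t : ℝ) :
    P {ω | ∑ i ∈ Finset.range N, c i + t / θ ≤
        ∑ i ∈ Finset.range N, h i (chain Φ Y z₀ i ω, Y i ω)}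
      ≤ ENNReal.ofReal (Real.exp (-t)) := by
  -- Factors from index `N` on are set to `1`, because the moment bound is available only below `N`.
  set g : ℕ → S × E → ENNReal := fun n q =>
    if n < N then ENNReal.ofReal (Real.exp (θ * h n q - θ * c n)) else 1 with hg
  have hgm : ∀ n, Measurable (g n) := by
    intro n
    by_cases hn : n < N
    · simp only [hg, hn, if_true]
      exact ENNReal.measurable_ofReal.comp
        (Real.measurable_exp.comp (((hh n).const_mul θ).sub_const _))
    · simp only [hg, hn, if_false]; exact measurable_const
  have hν : IsProbabilityMeasure ν := by
    rw [← hlaw 0]; exact Measure.isProbabilityMeasure_map (hY 0).aemeasurable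
  have hg1 : ∀ n z, ∫⁻ y, g n (z, y) ∂ν ≤ 1 := by
    intro n z
    by_cases hn : n < N
    · simp only [hg, hn, if_true]
      have h1 : ∀ y, ENNReal.ofReal (Real.exp (θ * h n (z, y) - θ * c n)) =
          ENNReal.ofReal (Real.exp (-(θ * c n))) * ENNReal.ofReal (Real.exp (θ * h n (z, y))) := by
        intro y
        rw [← ENNReal.ofReal_mul (Real.exp_pos _).le, ← Real.exp_add]
        ring_nf
      simp only [h1]
      rw [lintegral_const_mul']
      · refine (mul_le_mul_right (hmgf n hn z) _).trans ?_
        rw [← ENNReal.ofReal_mul (Real.exp_pos _).le, ← Real.exp_add]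
        simp
      · exact ENNReal.ofReal_ne_top
    · simp [hg, hn]
  have hle := lintegral_prod_chain_le_one hΦ hY hlaw hind z₀ hgm hg1 N
  have hprod : ∀ ω, ∏ i ∈ Finset.range N, g i (chain Φ Y z₀ i ω, Y i ω) =
      ENNReal.ofReal (Real.exp (θ * (∑ i ∈ Finset.range N, h i (chain Φ Y z₀ i ω, Y i ω)
        - ∑ i ∈ Finset.range N, c i))) := by
    intro ω
    rw [← Finset.sum_sub_distrib, Finset.mul_sum, Real.exp_sum,
      ENNReal.ofReal_prod_of_nonneg fun i _ => (Real.exp_pos _).le]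
    refine Finset.prod_congr rfl fun i hi => ?_
    simp only [hg, Finset.mem_range.1 hi, if_true]
    ring_nf
  have hmeas : Measurable fun ω => ∏ i ∈ Finset.range N, g i (chain Φ Y z₀ i ω, Y i ω) := by
    refine Finset.measurable_fun_prod _ fun i _ => (hgm i).comp (Measurable.prodMk ?_ (hY i))
    exact (measurable_chain hΦ z₀ i).mono (past_le hY i) le_rfl
  have hM := meas_ge_le_lintegral_div (μ := P) hmeas.aemeasurable
    (ε := ENNReal.ofReal (Real.exp t)) (by simpa using Real.exp_pos t) ENNReal.ofReal_ne_top
  refine (measure_mono fun ω hω => ?_).trans (hM.trans ?_)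
  · simp only [Set.mem_ofPred_eq] at hω ⊢
    rw [hprod]
    refine ENNReal.ofReal_le_ofReal (Real.exp_le_exp.2 ?_)
    have h1 : t / θ ≤ ∑ i ∈ Finset.range N, h i (chain Φ Y z₀ i ω, Y i ω)
        - ∑ i ∈ Finset.range N, c i := by linarith
    rw [div_le_iff₀ hθ] at h1
    linarith
  · refine (ENNReal.div_le_div_right hle _).trans ?_
    rw [one_div, Real.exp_neg, ENNReal.ofReal_inv_of_pos (Real.exp_pos t)]

/-! ### The deterministic recursion and scalar estimates. -/

theorem sum_le_sq_of_recursion {d q φ η U : ℕ → ℝ} {K : ℝ} (N : ℕ) (hd : ∀ i, 0 ≤ d i)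
    (hq : ∀ i, 0 ≤ q i) (hφ : ∀ i < N, 0 ≤ φ i)
    (hrec : ∀ i < N, d (i + 1) ^ 2 + φ i ≤ d i ^ 2 + η i + q i)
    (hη : ∀ i, d i = 0 → η i = 0) (hU0 : U 0 = d 0 ^ 2 + K)
    (hU : ∀ i < N, U (i + 1) = U i + η i) (hK : ∑ i ∈ Finset.range N, q i ≤ K) :
    0 ≤ d 0 + √K + ∑ i ∈ Finset.range N, η i / (2 * max (√(U i)) (d i)) ∧
    ∑ i ∈ Finset.range N, φ i ≤
      (d 0 + √K + ∑ i ∈ Finset.range N, η i / (2 * max (√(U i)) (d i))) ^ 2 := by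
  have hqK : ∀ n ≤ N, ∑ i ∈ Finset.range n, q i ≤ K := fun n hn =>
    (Finset.sum_le_sum_of_subset_of_nonneg (Finset.range_mono hn) fun i _ _ => hq i).trans hK
  have hK0 : 0 ≤ K := (Finset.sum_nonneg fun i _ => hq i).trans hK
  have hφ0 : ∀ n ≤ N, 0 ≤ ∑ i ∈ Finset.range n, φ i := fun n hn =>
    Finset.sum_nonneg fun i hi => hφ i ((Finset.mem_range.1 hi).trans_le hn)
  have key : ∀ n ≤ N, d n ^ 2 + ∑ i ∈ Finset.range n, φ i + (K - ∑ i ∈ Finset.range n, q i) ≤ U n ∧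
      √(U n) ≤ d 0 + √K + ∑ i ∈ Finset.range n, η i / (2 * max (√(U i)) (d i)) := by
    intro n
    induction n with
    | zero =>
      intro _
      refine ⟨by simp [hU0], ?_⟩
      rw [hU0, Finset.sum_range_zero, add_zero, Real.sqrt_le_left (add_nonneg (hd 0) (Real.sqrt_nonneg K))]
      nlinarith [Real.sq_sqrt hK0, mul_nonneg (hd 0) (Real.sqrt_nonneg K)]
    | succ n ih =>
      intro hn
      obtain ⟨h1, h2⟩ := ih (by omega)
      have hn' : n < N := hn
      have h3 := hrec n hn'
      have h4 := hU n hn'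
      refine ⟨?_, ?_⟩
      · rw [Finset.sum_range_succ, Finset.sum_range_succ]; linarith
      rw [Finset.sum_range_succ, ← add_assoc]
      refine le_trans ?_ (add_le_add_left h2 _)
      have hdU : d n ^ 2 ≤ U n := by linarith [hφ0 n hn'.le, hqK n hn'.le]
      have hU0 : 0 ≤ U n := (sq_nonneg _).trans hdU
      have hds : d n ≤ √(U n) := Real.le_sqrt_of_sq_le hdU
      -- While `∑ q ≤ K` the maximum is just `√(U n)`; the other entry serves the probabilistic
      -- side, where the direction must have norm at most one unconditionally.
      rw [max_eq_left hds, h4]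
      rcases (Real.sqrt_nonneg (U n)).eq_or_lt with h0 | h0
      · have : d n = 0 := le_antisymm (hds.trans h0.symm.le) (hd n)
        rw [hη n this]; simp
      · rw [Real.sqrt_le_iff]
        have h5 : U n + η n ≤ (√(U n) + η n / (2 * √(U n))) ^ 2 := by
          have : (√(U n) + η n / (2 * √(U n))) ^ 2 =
              U n + η n + (η n / (2 * √(U n))) ^ 2 := by
            field_simp
            rw [Real.sq_sqrt hU0]
            ring
          rw [this]
          linarith [sq_nonneg (η n / (2 * √(U n)))]
        refine ⟨?_, h5⟩
        have h6 : 0 ≤ U n + η n := by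
          have h7 := hqK (n + 1) hn
          rw [Finset.sum_range_succ] at h7
          linarith [hφ0 n hn'.le, hφ n hn', sq_nonneg (d (n + 1))]
        have h8 : -(U n) ≤ η n := by linarith
        have h9 : √(U n) + η n / (2 * √(U n)) = (2 * U n + η n) / (2 * √(U n)) := by
          field_simp
          rw [Real.sq_sqrt hU0]
          ring
        rw [h9]
        exact div_nonneg (by linarith) (by positivity)
  obtain ⟨h1, h2⟩ := key N le_rfl
  have h3 := hqK N le_rfl
  have hU0 : 0 ≤ U N := by linarith [hφ0 N le_rfl, sq_nonneg (d N)]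
  refine ⟨(Real.sqrt_nonneg _).trans h2, ?_⟩
  calc ∑ i ∈ Finset.range N, φ i ≤ U N := by linarith [sq_nonneg (d N)]
    _ = √(U N) ^ 2 := (Real.sq_sqrt hU0).symm
    _ ≤ _ := pow_le_pow_left₀ (Real.sqrt_nonneg _) h2 2

theorem sum_Icc_one_eq_sum_range {M : Type*} [AddCommMonoid M] (a : ℕ → M) (k : ℕ) :
    ∑ i ∈ Finset.Icc 1 k, a i = ∑ i ∈ Finset.range k, a (i + 1) := by
  induction k with
  | zero => simp
  | succ k ih => rw [Finset.sum_Icc_succ_top (by omega), Finset.sum_range_succ, ih]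

/-- This optimises the Chernoff exponent `x / C²` over `0 < x ≤ 1`. The balancing choice is `x = C√l
/ √B`, replaced by `1` when it would be at least `1`. -/
theorem exists_exponential_rate {B C l : ℝ} (hB : 0 ≤ B) (hC : 0 < C) (hl : 0 < l) :
    ∃ x, 0 < x ∧ x ≤ 1 ∧ (1 + x) * B + l / (x / C ^ 2) ≤ (√B + C * √l) ^ 2 := by
  have hl' : 0 < √l := Real.sqrt_pos.2 hl
  have h1 : (√B + C * √l) ^ 2 = B + 2 * (√B * (C * √l)) + C ^ 2 * l := by
    rw [add_sq, mul_pow, Real.sq_sqrt hB, Real.sq_sqrt hl.le]; ring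
  rw [h1]
  rcases le_or_gt (√B) (C * √l) with h | h
  · refine ⟨1, one_pos, le_rfl, ?_⟩
    have h2 : B ≤ √B * (C * √l) := by
      nth_rewrite 1 [← Real.mul_self_sqrt hB]
      exact mul_le_mul_of_nonneg_left h (Real.sqrt_nonneg _)
    have h3 : l / (1 / C ^ 2) = C ^ 2 * l := by field_simp
    linarith
  · have hCl : 0 < C * √l := mul_pos hC hl'
    have hB' : 0 < √B := hCl.trans h
    refine ⟨C * √l / √B, by positivity, (div_le_one hB').2 h.le, ?_⟩
    have h2 : C * √l / √B * B = √B * (C * √l) := by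
      nth_rewrite 2 [← Real.mul_self_sqrt hB]
      field_simp
    have h3 : l / (C * √l / √B / C ^ 2) = √B * (C * √l) := by
      nth_rewrite 1 [← Real.mul_self_sqrt hl.le]
      field_simp
    have h4 : 0 ≤ C ^ 2 * l := by positivity
    rw [h3, add_mul, h2]
    linarith

/-- As `√l ≤ l`, the term `C√l` from `√K` joins `(5/3) C l` to make the factor `8/3`. The terms with
`D` and `E`, and `B` outside the root, are slack. -/
theorem radius_le {r A B C D E S l : ℝ} (hB : 0 ≤ B) (hC : 0 ≤ C) (hD : 0 ≤ D) (hl : 1 ≤ l)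
    (hS : S ≤ A + 5 / 3 * C * l) :
    r + (√B + C * √l) + S ≤ r + A + B + 8 / 3 * (C + D) * l + (√B + √E) * √l := by
  have hsl : 1 ≤ √l := Real.one_le_sqrt.2 hl
  have h3 : √l ≤ l := by
    nth_rewrite 2 [← Real.mul_self_sqrt (by linarith : 0 ≤ l)]
    exact le_mul_of_one_le_left (by linarith) hsl
  have h4 : C * √l ≤ C * l := mul_le_mul_of_nonneg_left h3 hC
  have h5 : √B ≤ √B * √l := le_mul_of_one_le_right (Real.sqrt_nonneg _) hsl
  have h6 : 0 ≤ √E * √l := by positivity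
  have h7 : 0 ≤ D * l := mul_nonneg hD (by linarith)
  have h8 : 8 / 3 * (C + D) * l = 5 / 3 * C * l + C * l + 8 / 3 * (D * l) := by ring
  rw [h8, add_mul]
  linarith

theorem norm_proj_step_sq_add_le {H : Type*} [NormedAddCommGroup H] [InnerProductSpace ℝ H]
    [CompleteSpace H] {X : Set H} (hne : X.Nonempty) (hcl : IsClosed X) (hcv : Convex ℝ X)
    {f : H → ℝ} {x y u v : H} (hy : y ∈ X) (hu : u ∈ subdifferential f x) {γ : ℝ} (hγ : 0 ≤ γ) :
    ‖proj X (x - γ • v) - y‖ ^ 2 + 2 * γ * (f x - f y)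
      ≤ ‖x - y‖ ^ 2 + 2 * γ * inner ℝ (u - v) (x - y) + γ ^ 2 * ‖v‖ ^ 2 := by
  have h1 := pow_le_pow_left₀ (norm_nonneg _) (norm_proj_sub_le hne hcl hcv (x - γ • v) hy) 2
  have h2 : ‖x - γ • v - y‖ ^ 2 = ‖x - y‖ ^ 2 - 2 * γ * inner ℝ v (x - y) + γ ^ 2 * ‖v‖ ^ 2 := by
    rw [sub_right_comm, norm_sub_sq_real, real_inner_smul_right, norm_smul, mul_pow,
      Real.norm_eq_abs, sq_abs, real_inner_comm]
    ring
  have h3 := hu y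
  have h4 : inner ℝ u (y - x) = -inner ℝ u (x - y) := by rw [← inner_neg_right, neg_sub]
  have h5 : 2 * γ * (f x - f y) ≤ 2 * γ * inner ℝ u (x - y) :=
    mul_le_mul_of_nonneg_left (by linarith) (by linarith)
  rw [inner_sub_left]
  linarith

/-- Gaps are nonnegative, so every weight `γ i` may be lowered to `γ k`; then Jensen's inequality
applies. -/
theorem avg_gap_mul_le {H : Type*} [NormedAddCommGroup H] [InnerProductSpace ℝ H]
    {f : H → ℝ} (hf : ConvexOn ℝ Set.univ f) {x : ℕ → H} {γ : ℕ → ℝ} {k : ℕ} (hk : 1 ≤ k)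
    (hγ : 0 ≤ γ k) (hγ_dec : ∀ i, 1 ≤ i → γ (i + 1) ≤ γ i) {fs : ℝ}
    (hfs : ∀ i, 1 ≤ i → fs ≤ f (x i)) :
    2 * k * γ k * (f ((1 / (k : ℝ)) • ∑ i ∈ Finset.Icc 1 k, x i) - fs)
      ≤ ∑ i ∈ Finset.range k, 2 * γ (i + 1) * (f (x (i + 1)) - fs) := by
  have hk0 : (0 : ℝ) < k := by exact_mod_cast hk
  have hcard : ∑ _i ∈ Finset.Icc 1 k, (1 / (k : ℝ)) = 1 := by
    rw [Finset.sum_const, Nat.card_Icc, nsmul_eq_mul]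
    simp [hk0.ne']
  have hJ := hf.map_sum_le (t := Finset.Icc 1 k) (w := fun _ => 1 / (k : ℝ)) (p := x)
    (fun i _ => by positivity) hcard (fun i _ => Set.mem_univ _)
  rw [← Finset.smul_sum, ← Finset.smul_sum, smul_eq_mul] at hJ
  have hγk : ∀ i, 1 ≤ i → ∀ j, i ≤ j → γ j ≤ γ i := fun i hi j hj => by
    induction j, hj using Nat.le_induction with
    | base => exact le_rfl
    | succ j hj ih => exact (hγ_dec j (hi.trans hj)).trans ih
  have h1 : ∑ i ∈ Finset.Icc 1 k, 2 * γ k * (f (x i) - fs)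
      ≤ ∑ i ∈ Finset.Icc 1 k, 2 * γ i * (f (x i) - fs) := by
    refine Finset.sum_le_sum fun i hi => ?_
    obtain ⟨h1, h2⟩ := Finset.mem_Icc.1 hi
    exact mul_le_mul_of_nonneg_right (by linarith [hγk i h1 k h2]) (by linarith [hfs i h1])
  rw [← Finset.mul_sum, Finset.sum_sub_distrib, Finset.sum_const, Nat.card_Icc, nsmul_eq_mul,
    Nat.add_sub_cancel] at h1
  rw [← sum_Icc_one_eq_sum_range (fun i => 2 * γ i * (f (x i) - fs))]
  refine le_trans ?_ h1
  have h2 : 2 * γ k * (∑ i ∈ Finset.Icc 1 k, f (x i) - k * fs)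
      = 2 * k * γ k * (1 / k * ∑ i ∈ Finset.Icc 1 k, f (x i) - fs) := by
    field_simp
  rw [h2]
  exact mul_le_mul_of_nonneg_left (by linarith) (by positivity)

end CSSGM

/-! ### Assembly of the high-probability bound. -/

theorem mainTheorem5
    {H : Type*} [NormedAddCommGroup H] [InnerProductSpace ℝ H] [CompleteSpace H]
    [TopologicalSpace.SeparableSpace H] [MeasurableSpace H] [BorelSpace H]
    {Ξ : Type*} [MeasurableSpace Ξ]
    {Ω : Type*} [MeasurableSpace Ω] (P : Measure Ω) [IsProbabilityMeasure P]
    -- the convex Lipschitz objective and the constraint set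
    (f : H → ℝ) (L : ℝ) (hL : 0 < L) (hf_conv : ConvexOn ℝ Set.univ f)
    (hf_lip : LipschitzWith L.toNNReal f)
    (X : Set H) (hX_ne : X.Nonempty) (hX_closed : IsClosed X) (hX_conv : Convex ℝ X)
    -- the stochastic subgradient oracle on `X`
    (ξ : Ω → Ξ) (hξ : Measurable ξ) (uhat : H → Ξ → H)
    (huhat_meas : Measurable (fun z : X × Ξ => uhat z.1 z.2))
    (huhat_int : ∀ x ∈ X, Integrable (fun ω => uhat x (ξ ω)) P)
    (huhat_subgrad : ∀ x ∈ X, ∫ ω, uhat x (ξ ω) ∂P ∈ CSSGM.subdifferential f x)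
    -- bounded moments of order `p` of the noise
    (p σ : ℝ) (hp1 : 1 < p) (hp2 : p ≤ 2) (hσ : 0 ≤ σ)
    (hnoise : ∀ x ∈ X,
      ∫⁻ ω, ‖uhat x (ξ ω) - ∫ ω', uhat x (ξ ω') ∂P‖ₑ ^ p ∂P ≤ ENNReal.ofReal (σ ^ p))
    -- the minibatch of size `m` and its noise level `σm`
    (m : ℕ) (hm : 1 ≤ m) (σm : ℝ) (hσm : 0 ≤ σm)
    (hbatch_noise : ∀ x ∈ X,
      ∫⁻ z, ‖CSSGM.batchMean uhat x z -
          ∫ z', CSSGM.batchMean uhat x z' ∂(Measure.pi fun _ : Fin m => P.map ξ)‖ₑ ^ p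
        ∂(Measure.pi fun _ : Fin m => P.map ξ) ≤ ENNReal.ofReal (σm ^ p))
    -- the draws: copies of `ξ`, independent within each batch and across batches
    (ξs : ℕ → Fin m → Ω → Ξ) (hξs_meas : ∀ k, 1 ≤ k → ∀ j, Measurable (ξs k j))
    (hξs_copy : ∀ k, 1 ≤ k → ∀ j, IdentDistrib (ξs k j) ξ P P)
    (hξs_indep : ∀ k, 1 ≤ k → iIndepFun (fun j => ξs k j) P)
    (hξs_batch_indep : iIndepFun (fun (k : Set.Ici (1 : ℕ)) (ω : Ω) (j : Fin m) => ξs k j ω) P)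
    -- step sizes, clipping levels and the initial point
    (γ lam : ℕ → ℝ) (hγ_pos : ∀ k, 1 ≤ k → 0 < γ k) (hγ_dec : ∀ k, 1 ≤ k → γ (k + 1) ≤ γ k)
    (ε : ℝ) (hε : 0 < ε) (hlam : ∀ k, 1 ≤ k → (1 + ε) * L ≤ lam k)
    (x₁ : H) (hx₁ : x₁ ∈ X)
    -- a minimizer and the minimum of `f` on `X`
    (xs : H) (hxs : xs ∈ X) (hxs_min : ∀ y ∈ X, f xs ≤ f y)
    (fs : ℝ) (hfs : IsLeast (f '' X) fs)
    (δ : ℝ) (hδ0 : 0 < δ) (hδ1 : δ ≤ 2 / Real.exp 1)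
    (k : ℕ) (hk : 1 ≤ k) :
    ENNReal.ofReal (1 - δ) ≤
      P {ω | f (CSSGM.avgIterate X uhat γ lam x₁ ξs k ω) - fs ≤
        1 / (2 * k * γ k) *
          (‖x₁ - xs‖ + CSSGM.seqA p ε σm γ lam k + CSSGM.seqB p L σm γ lam k
            + 8 / 3 * (CSSGM.seqC γ lam k hk + CSSGM.seqD γ lam k hk) * Real.log (2 / δ)
            + (√(CSSGM.seqB p L σm γ lam k) + √(CSSGM.seqE p L σm γ lam k))
              * √(Real.log (2 / δ))) ^ 2} := by
  have : SecondCountableTopology H := UniformSpace.secondCountable_of_separable H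
  set μ : Measure Ξ := P.map ξ with hμ
  have : IsProbabilityMeasure μ := Measure.isProbabilityMeasure_map hξ.aemeasurable
  set ν : Measure (Fin m → Ξ) := Measure.pi fun _ => μ with hν
  -- the mean subgradient
  set u : H → H := fun x => ∫ y, uhat x y ∂μ with hu_def
  have huhat_x : ∀ x ∈ X, Measurable (uhat x) := fun x hx =>
    huhat_meas.comp (measurable_prodMk_left (x := (⟨x, hx⟩ : X)))
  have hu_eq : ∀ x ∈ X, ∫ ω, uhat x (ξ ω) ∂P = u x := fun x hx =>
    (integral_map hξ.aemeasurable (huhat_x x hx).aestronglyMeasurable).symm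
  have huhat_int' : ∀ x ∈ X, Integrable (uhat x) μ := fun x hx =>
    (integrable_map_measure (huhat_x x hx).aestronglyMeasurable hξ.aemeasurable).2
      (huhat_int x hx)
  have hu_sub : ∀ x ∈ X, u x ∈ CSSGM.subdifferential f x := fun x hx =>
    hu_eq x hx ▸ huhat_subgrad x hx
  have hu_norm : ∀ x ∈ X, ‖u x‖ ≤ L := fun x hx =>
    CSSGM.norm_le_of_mem_subdifferential hL hf_lip (hu_sub x hx)
  have hu_meas : Measurable fun x : X => u x := by
    have h1 : StronglyMeasurable (Function.uncurry fun (x : X) (y : Ξ) => uhat x y) :=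
      huhat_meas.stronglyMeasurable
    exact h1.integral_prod_right.measurable
  have hbm_int : ∀ x ∈ X, Integrable (fun z => CSSGM.batchMean uhat x z) ν := fun x hx =>
    CSSGM.integrable_batchMean (huhat_int' x hx)
  have hbm_mean : ∀ x ∈ X, ∫ z, CSSGM.batchMean uhat x z ∂ν = u x := fun x hx =>
    CSSGM.integral_batchMean hm (huhat_int' x hx)
  have hbm_mom : ∀ x ∈ X, ∫⁻ z, ‖CSSGM.batchMean uhat x z - u x‖ₑ ^ p ∂ν
      ≤ ENNReal.ofReal (σm ^ p) := fun x hx => by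
    have := hbatch_noise x hx
    rwa [hbm_mean x hx] at this
  -- the noise sequence
  set Y : ℕ → Ω → Fin m → Ξ := fun n ω j => ξs (n + 1) j ω with hY_def
  have hY : ∀ n, Measurable (Y n) := fun n =>
    measurable_pi_iff.2 fun j => hξs_meas (n + 1) (by omega) j
  have hlaw : ∀ n, P.map (Y n) = ν := fun n => by
    have h1 := (iIndepFun_iff_map_fun_eq_pi_map
      fun j => (hξs_meas (n + 1) (by omega) j).aemeasurable).1 (hξs_indep (n + 1) (by omega))
    simp only [fun j => (hξs_copy (n + 1) (by omega) j).map_eq] at h1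
    exact h1
  have hind : iIndepFun Y P := by
    have hinj : Function.Injective fun n : ℕ => (⟨n + 1, by simp⟩ : Set.Ici (1 : ℕ)) :=
      fun a b hab => by simpa using congrArg Subtype.val hab
    exact hξs_batch_indep.precomp hinj
  -- the constants
  have hl : ∀ n, 0 < lam (n + 1) := fun n =>
    lt_of_lt_of_le (by positivity) (hlam (n + 1) (by omega))
  have hγ : ∀ n, 0 < γ (n + 1) := fun n => hγ_pos (n + 1) (by omega)
  set A := CSSGM.seqA p ε σm γ lam k with hA
  set B := CSSGM.seqB p L σm γ lam k with hB
  set C := CSSGM.seqC γ lam k hk with hC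
  set D := CSSGM.seqD γ lam k hk with hD
  set E := CSSGM.seqE p L σm γ lam k with hE
  set l := Real.log (2 / δ) with hl_def
  -- This is where `δ ≤ 2/e` enters.
  have hl1 : 1 ≤ l := by
    rw [hl_def, Real.le_log_iff_exp_le (by positivity), le_div_iff₀ hδ0]
    rw [le_div_iff₀ (Real.exp_pos 1)] at hδ1
    linarith
  have hexpl : Real.exp (-l) = δ / 2 := by
    rw [Real.exp_neg, hl_def, Real.exp_log (by positivity), inv_div]
  have hb0 : 0 ≤ CSSGM.bConst p L σm := by unfold CSSGM.bConst; positivity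
  have hB_eq : B = ∑ i ∈ Finset.range k,
      γ (i + 1) ^ 2 * (CSSGM.bConst p L σm * lam (i + 1) ^ (2 - p)) := by
    rw [hB, CSSGM.seqB, CSSGM.sum_Icc_one_eq_sum_range, Finset.mul_sum]
    exact Finset.sum_congr rfl fun i _ => by ring
  have hA_eq : A = ∑ i ∈ Finset.range k,
      γ (i + 1) * (CSSGM.aConst p ε σm / lam (i + 1) ^ (p - 1)) := by
    rw [hA, CSSGM.seqA, CSSGM.sum_Icc_one_eq_sum_range, Finset.mul_sum]
    exact Finset.sum_congr rfl fun i _ => by ring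
  have hB0 : 0 ≤ B := by
    rw [hB_eq]
    exact Finset.sum_nonneg fun i _ => by have := hl i; positivity
  have hCi : ∀ i < k, γ (i + 1) * lam (i + 1) ≤ C := fun i hi =>
    Finset.le_sup' (fun i => γ i * lam i) (Finset.mem_Icc.2 ⟨by omega, by omega⟩)
  have hC0 : 0 < C := (mul_pos (hγ 0) (hl 0)).trans_le (hCi 0 (by omega))
  have hD0 : 0 ≤ D := by
    refine le_trans ?_ (Finset.le_sup' (fun i => γ i ^ 2 * lam i ^ 2)
      (Finset.mem_Icc.2 ⟨le_rfl, hk⟩))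
    positivity
  set K := (√B + C * √l) ^ 2 with hK
  have hsK : √K = √B + C * √l := Real.sqrt_sq (by positivity)
  -- the state of the method, enlarged by the potential
  set ct : ℕ → (X × ℝ) × (Fin m → Ξ) → H := fun n q =>
    CSSGM.clip (CSSGM.batchMean uhat q.1.1 q.2) (lam (n + 1)) with hct
  set inc : ℕ → (X × ℝ) × (Fin m → Ξ) → ℝ := fun n q =>
    2 * γ (n + 1) * inner ℝ (u q.1.1 - ct n q) ((q.1.1 : H) - xs) with hinc
  -- The state lies in the subtype `X` because the oracle is measurable only there. It carries the
  -- potential so that the normalising factor is a function of the state. Time `n` of the chain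
  -- corresponds to iterate `n + 1`.
  set Φ : ℕ → (X × ℝ) × (Fin m → Ξ) → X × ℝ := fun n q =>
    (⟨CSSGM.proj X (q.1.1 - γ (n + 1) • ct n q),
      (CSSGM.proj_spec hX_ne hX_closed hX_conv _).1⟩, q.1.2 + inc n q) with hΦ_def
  have hx_meas : Measurable fun q : (X × ℝ) × (Fin m → Ξ) => (q.1.1 : H) :=
    measurable_subtype_coe.comp (measurable_fst.comp measurable_fst)
  have hct_meas : ∀ n, Measurable (ct n) := fun n => by
    refine (CSSGM.continuous_clip (lam (n + 1))).measurable.comp ?_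
    refine Measurable.const_smul (Finset.measurable_fun_sum _ fun j _ => ?_) _
    exact huhat_meas.comp ((measurable_fst.comp measurable_fst).prodMk
      ((measurable_pi_apply j).comp measurable_snd))
  have hinc_meas : ∀ n, Measurable (inc n) := fun n =>
    (((hu_meas.comp (measurable_fst.comp measurable_fst)).sub (hct_meas n)).inner
      (hx_meas.sub_const xs)).const_mul _
  have hΦ : ∀ n, Measurable (Φ n) := fun n => by
    refine Measurable.prodMk (Measurable.subtype_mk ?_)
      ((measurable_snd.comp measurable_fst).add (hinc_meas n))
    exact (CSSGM.continuous_proj hX_ne hX_closed hX_conv).measurable.comp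
      (hx_meas.sub ((hct_meas n).const_smul (γ (n + 1))))
  set z₀ : X × ℝ := (⟨x₁, hx₁⟩, ‖x₁ - xs‖ ^ 2 + K) with hz₀
  set Z := CSSGM.chain Φ Y z₀ with hZ
  have hiter : ∀ n ω, CSSGM.iterate X uhat γ lam x₁ ξs (n + 1) ω = (Z n ω).1 := by
    intro n ω
    induction n with
    | zero => rfl
    | succ n ih =>
      simp only [CSSGM.iterate, ih]
      rfl
  set ζ : ℕ → (X × ℝ) × (Fin m → Ξ) → ℝ := fun n q =>
    inc n q / (2 * max (√q.1.2) ‖(q.1.1 : H) - xs‖) with hζ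
  have hζ_meas : ∀ n, Measurable (ζ n) := fun n =>
    (hinc_meas n).div (((measurable_snd.comp measurable_fst).sqrt.max
      (hx_meas.sub_const xs).norm).const_mul 2)
  set q : ℕ → (X × ℝ) × (Fin m → Ξ) → ℝ := fun n w => γ (n + 1) ^ 2 * ‖ct n w‖ ^ 2 with hq
  have hq_meas : ∀ n, Measurable (q n) := fun n => ((hct_meas n).norm.pow_const 2).const_mul _
  -- the squared norms of the clipped subgradients
  have hbad1 : P {ω | K ≤ ∑ i ∈ Finset.range k, q i (Z i ω, Y i ω)} ≤ ENNReal.ofReal (δ / 2) := by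
    obtain ⟨x, hx0, hx1, hxK⟩ := CSSGM.exists_exponential_rate hB0 hC0 (by linarith : 0 < l)
    have h1 := CSSGM.measure_sum_chain_ge_le hΦ hY hlaw hind z₀ hq_meas
      (θ := x / C ^ 2) (by positivity) (N := k)
      (c := fun i => γ (i + 1) ^ 2 * ((1 + x) *
        (CSSGM.bConst p L σm * lam (i + 1) ^ (2 - p)))) (fun n hn z => ?_) l
    · rw [hexpl] at h1
      refine (measure_mono fun ω hω => ?_).trans h1
      rw [Set.mem_ofPred_eq] at hω ⊢
      refine le_trans (le_trans (le_of_eq ?_) hxK) hω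
      rw [hB_eq, Finset.mul_sum]
      congr 1
      exact Finset.sum_congr rfl fun i _ => by ring
    · have hxC : x / C ^ 2 * γ (n + 1) ^ 2 * lam (n + 1) ^ 2 ≤ x := by
        have h2 := pow_le_pow_left₀ (mul_pos (hγ n) (hl n)).le (hCi n hn) 2
        rw [mul_assoc, ← mul_pow, div_mul_eq_mul_div, div_le_iff₀ (by positivity)]
        exact mul_le_mul_of_nonneg_left h2 hx0.le
      have h3 := CSSGM.lintegral_exp_norm_clip_sq_le (hbm_int _ z.1.2) hL (hl n)
        (hu_norm _ z.1.2) hp1 hp2 hσm (hbm_mom _ z.1.2) (by positivity) hx1 hxC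
      simpa only [hq, hct, mul_assoc] using h3
  -- the noise in the direction of the minimizer
  have hbad2 : P {ω | A + 5 / 3 * C * l ≤ ∑ i ∈ Finset.range k, ζ i (Z i ω, Y i ω)}
      ≤ ENNReal.ofReal (δ / 2) := by
    have h1 := CSSGM.measure_sum_chain_ge_le hΦ hY hlaw hind z₀ hζ_meas
      -- This `θ` keeps `θ γ λ ≤ 3/5` at every step, as the moment bound requires, and yields the
      -- deviation `l / θ = (5/3) C l`.
      (θ := 3 / (5 * C)) (by positivity) (N := k)
      (c := fun i => γ (i + 1) * (CSSGM.aConst p ε σm / lam (i + 1) ^ (p - 1)))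
      (fun n hn z => ?_) l
    · rw [hexpl] at h1
      refine (measure_mono fun ω hω => ?_).trans h1
      rw [Set.mem_ofPred_eq] at hω ⊢
      refine le_trans (le_of_eq ?_) hω
      rw [hA_eq]
      congr 1
      field_simp
    · set M := max (√z.2) ‖(z.1 : H) - xs‖ with hM
      -- If `M = 0` then `e = 0`, so the norm bound holds in every state, including those with
      -- negative potential.
      set e : H := M⁻¹ • ((z.1 : H) - xs) with he
      have hM0 : 0 ≤ M := (Real.sqrt_nonneg _).trans (le_max_left _ _)
      have he1 : ‖e‖ ≤ 1 := by
        rw [he, norm_smul, norm_inv, Real.norm_of_nonneg hM0, inv_mul_eq_div]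
        exact div_le_one_of_le₀ (le_max_right _ _) hM0
      have hτl : 3 / (5 * C) * γ (n + 1) * lam (n + 1) ≤ 3 / 5 := by
        rw [mul_assoc, div_mul_eq_mul_div, div_le_iff₀ (by positivity)]
        linarith [hCi n hn]
      have h3 := CSSGM.lintegral_exp_inner_clip_le (hbm_int _ z.1.2) (hbm_mean _ z.1.2) hL hε
        (hu_norm _ z.1.2) (hlam (n + 1) (by omega)) hp1 hp2 hσm (hbm_mom _ z.1.2) he1
        (mul_nonneg (by positivity) (hγ n).le) hτl
      rw [mul_assoc] at h3
      refine le_trans (lintegral_mono fun y => le_of_eq ?_) h3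
      have h4 : ζ n (z, y) = γ (n + 1) * inner ℝ (u z.1 - CSSGM.clip
          (CSSGM.batchMean uhat (z.1 : H) y) (lam (n + 1))) e := by
        rw [he, real_inner_smul_right]
        simp only [hζ, hinc, hct, ← hM]
        rw [mul_assoc, mul_div_mul_left _ _ two_ne_zero, div_eq_inv_mul]
        ring
      rw [h4, mul_assoc]
  -- the bound holds off the two exceptional events
  have hfs_eq : fs = f xs := by
    obtain ⟨⟨y, hy, rfl⟩, h2⟩ := hfs
    exact le_antisymm (h2 ⟨xs, hxs, rfl⟩) (hxs_min y hy)
  -- Covering the whole space and using subadditivity avoids any measurability claim about the good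
  -- event.
  have hcover : (Set.univ : Set Ω) ⊆ {ω | f (CSSGM.avgIterate X uhat γ lam x₁ ξs k ω) - fs ≤
        1 / (2 * k * γ k) * (‖x₁ - xs‖ + A + B + 8 / 3 * (C + D) * l + (√B + √E) * √l) ^ 2} ∪
      ({ω | K ≤ ∑ i ∈ Finset.range k, q i (Z i ω, Y i ω)} ∪
        {ω | A + 5 / 3 * C * l ≤ ∑ i ∈ Finset.range k, ζ i (Z i ω, Y i ω)}) := by
    intro ω _
    by_contra hω
    simp only [Set.mem_union, Set.mem_ofPred_eq, not_or, not_le] at hω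
    obtain ⟨hω1, hω2, hω3⟩ := hω
    refine absurd hω1 (not_lt.2 ?_)
    obtain ⟨hdet0, hdet⟩ := CSSGM.sum_le_sq_of_recursion (d := fun i => ‖((Z i ω).1 : H) - xs‖)
      (q := fun i => q i (Z i ω, Y i ω))
      (φ := fun i => 2 * γ (i + 1) * (f (Z i ω).1 - fs))
      (η := fun i => inc i (Z i ω, Y i ω)) (U := fun i => (Z i ω).2) (K := K) k
      (fun i => norm_nonneg _) (fun i => by simp only [hq]; positivity)
      (fun i _ => mul_nonneg (by linarith [hγ i]) (by
        rw [hfs_eq]; linarith [hxs_min _ (Z i ω).1.2]))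
      (fun i _ => by
        rw [hfs_eq]
        exact CSSGM.norm_proj_step_sq_add_le hX_ne hX_closed hX_conv hxs
          (hu_sub _ (Z i ω).1.2) (hγ i).le)
      (fun i hi => by
        simp only [hinc]
        rw [norm_eq_zero.1 hi, inner_zero_right, mul_zero]) rfl (fun i _ => rfl) hω2.le
    have hk0 : (0 : ℝ) < k := by exact_mod_cast hk
    have hgap := CSSGM.avg_gap_mul_le hf_conv
      (x := fun i => CSSGM.iterate X uhat γ lam x₁ ξs i ω) hk (hγ_pos k hk).le hγ_dec (fs := fs)
      (fun i hi => by
        obtain ⟨j, rfl⟩ : ∃ j, i = j + 1 := ⟨i - 1, by omega⟩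
        rw [hiter, hfs_eq]
        exact hxs_min _ (Z j ω).1.2)
    simp only [hiter] at hgap
    have hfinal := hgap.trans (hdet.trans (pow_le_pow_left₀ hdet0
      (?_ : _ ≤ ‖x₁ - xs‖ + A + B + 8 / 3 * (C + D) * l + (√B + √E) * √l) 2))
    · have hγk := hγ_pos k hk
      rw [one_div_mul_eq_div, le_div_iff₀ (by positivity), mul_comm]
      exact hfinal
    · rw [hsK]
      exact CSSGM.radius_le hB0 hC0.le hD0 hl1 hω3.le
  have hP := (measure_mono hcover).trans ((measure_union_le (μ := P) _ _).trans
    (add_le_add_right ((measure_union_le _ _).trans (add_le_add hbad1 hbad2)) _))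
  rw [measure_univ, ← ENNReal.ofReal_add (by linarith) (by linarith), add_halves] at hP
  rw [ENNReal.ofReal_sub _ hδ0.le, ENNReal.ofReal_one]
  exact tsub_le_iff_right.2 hP
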